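/- For a group $G$, the enhanced power graph $\mathcal{P}_e(G)$ is the simple graph with vertex set $G$ in which two distinct vertices $x,y$ are adjacent if and only if $x,y\in\langle z\rangle$ for some $z\in G$. A spanning tree of a graph $\Gamma$ is a subgraph of $\Gamma$ with vertex set $V(\Gamma)$ that is connected and acyclic. For every integer $n\ge 1$, let $$Q_{4n}=\langle a,b : a^{2n}=e,\ b^2=a^n,\ b^{-1}ab=a^{-1}\rangle$$ be the generalized quaternion (dicyclic) group of order $4n$, and let $$D_{2n}=\langle a,b : a^n=b^2=e,\ bab^{-1}=a^{-1}\rangle$$ be the dihedral group of order $2n$. Then: 1. the number of spanning trees of $\mathcal{P}_e(Q_{4n})$ is $2^{5n-1}n^{2n-2}$; 2. the number of spanning trees of $\mathcal{P}_e(D_{2n})$ is $n^{n-2}$. -/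

import Mathlib

/-- The enhanced power graph of a group `G`: its vertices are the elements of `G`, and two distinct
vertices are adjacent when both lie in the cyclic subgroup generated by some element of `G`. -/
def enhancedPowerGraph (G : Type*) [Group G] : SimpleGraph G where
  Adj x y := x ≠ y ∧ ∃ z : G, x ∈ Subgroup.zpowers z ∧ y ∈ Subgroup.zpowers z
  symm := ⟨fun _ _ h => ⟨h.1.symm, h.2.imp fun _ hz => ⟨hz.2, hz.1⟩⟩⟩
  loopless := ⟨fun _ h => h.1 rfl⟩

/-- The spanning trees of a graph `Γ`: the subgraphs of `Γ` on the full vertex set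
(that is, the graphs `T ≤ Γ` on the same vertex type) which are connected and acyclic. -/
def spanningTrees {V : Type*} (Γ : SimpleGraph V) : Set (SimpleGraph V) :=
  {T | T ≤ Γ ∧ T.IsTree}

/-- The number of spanning trees of a graph (used for graphs on finite vertex sets). -/
noncomputable def numSpanningTrees {V : Type*} (Γ : SimpleGraph V) : ℕ :=
  (spanningTrees Γ).ncard

/-! Both counts come from the matrix-tree theorem `numSpanningTrees_eq_det`, proved by identifying
spanning trees with parent functions towards a root and expanding the Laplacian determinant row by
row over choices of parents. In the dihedral group the rotations form a clique `K_n` and each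
reflection is a leaf attached to the identity, so the count is Cayley's `n ^ (n - 2)`. In the
quaternion group the elements `a i` form a clique `K_{2n}`, and `xa i` is adjacent exactly to `a 0`,
`a n` and its inverse `xa (i + n)`. Replacing the rows of both universal vertices `a 0`, `a n` by
unit vectors makes the matrix block triangular. The clique block has determinant `2 * (2n) ^ (2n -
3)`, and the `n` inverse pairs contribute `8` each. `two_mul_det_rootedLapMatrix_of_universal`
converts back to one root by the factor `4n / 2`, giving `2 * (2n) ^ (2n - 2) * 8 ^ n`. -/

open Finset Matrix

/-! ### Spanning trees as parent functions -/

namespace SimpleGraph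

variable {V : Type*}

/-- The graph joining every vertex `v ≠ r` to its parent `f v`. -/
def parentGraph (r : V) (f : V → V) : SimpleGraph V :=
  fromRel fun v w => v ≠ r ∧ f v = w

/-- `f` is a parent function of a spanning tree of `Γ` rooted at `r`. -/
structure IsParentFun (Γ : SimpleGraph V) (r : V) (f : V → V) : Prop where
  root : f r = r
  adj : ∀ v, v ≠ r → Γ.Adj v (f v)
  reach : ∀ v, ∃ k, f^[k] v = r

lemma IsParentFun.induction {Γ : SimpleGraph V} {r : V} {f : V → V} (h : Γ.IsParentFun r f)
    {p : V → Prop} (hr : p r) (hs : ∀ v, v ≠ r → p (f v) → p v) (v : V) : p v := by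
  obtain ⟨k, hk⟩ := h.reach v
  induction k generalizing v with
  | zero => exact (show v = r from hk) ▸ hr
  | succ k ih =>
    by_cases hv : v = r
    · exact hv ▸ hr
    · exact hs v hv (ih (f v) hk)

lemma IsParentFun.parentGraph_adj {Γ : SimpleGraph V} {r : V} {f : V → V}
    (h : Γ.IsParentFun r f) {v : V} (hv : v ≠ r) : (parentGraph r f).Adj v (f v) :=
  ⟨(h.adj v hv).ne, Or.inl ⟨hv, rfl⟩⟩

lemma IsParentFun.parentGraph_le {Γ : SimpleGraph V} {r : V} {f : V → V}
    (h : Γ.IsParentFun r f) : parentGraph r f ≤ Γ := by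
  rintro v w ⟨_, ⟨hv, rfl⟩ | ⟨hw, rfl⟩⟩
  · exact h.adj v hv
  · exact (h.adj w hw).symm

lemma IsParentFun.connected {Γ : SimpleGraph V} {r : V} {f : V → V}
    (h : Γ.IsParentFun r f) : (parentGraph r f).Connected := by
  have key : ∀ v, (parentGraph r f).Reachable v r :=
    h.induction (Reachable.refl r) fun v hv hf => (h.parentGraph_adj hv).reachable.trans hf
  have : Nonempty V := ⟨r⟩
  exact ⟨fun v w => (key v).trans (key w).symm⟩

/-- Each edge is `s(v, f v)` for some `v ≠ r`, so there are at most `|V| - 1` edges; a connected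
graph with so few edges is a tree. -/
lemma IsParentFun.isTree [Finite V] {Γ : SimpleGraph V} {r : V} {f : V → V}
    (h : Γ.IsParentFun r f) : (parentGraph r f).IsTree := by
  classical
  have := Fintype.ofFinite V
  rw [isTree_iff_connected_and_card]
  refine ⟨h.connected, le_antisymm ?_ h.connected.card_vert_le_card_edgeSet_add_one⟩
  have hsub : (parentGraph r f).edgeSet ⊆ ((univ.erase r).image fun v => s(v, f v) : Finset _) := by
    intro e
    induction e with
    | _ v w =>
      rintro ⟨_, ⟨hv, h2⟩ | ⟨hw, h2⟩⟩ <;> dsimp only at * <;> subst h2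
      · simp only [coe_image, Set.mem_image]
        exact ⟨v, by simpa using hv, rfl⟩
      · simp only [coe_image, Set.mem_image]
        exact ⟨w, by simpa using hw, Sym2.eq_swap⟩
  have h1 := Nat.card_mono (Finset.finite_toSet _) hsub
  rw [Nat.card_eq_fintype_card (α := ((_ : Finset (Sym2 V)) : Set (Sym2 V)))] at h1
  simp only [Fintype.card_coe, Finset.coe_sort_coe] at h1
  have h2 := h1.trans card_image_le
  rw [card_erase_of_mem (mem_univ r), card_univ] at h2
  have : 0 < Fintype.card V := Fintype.card_pos_iff.2 ⟨r⟩
  rw [Nat.card_eq_fintype_card (α := V)]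
  omega

lemma IsParentFun.eq_of_parentGraph_eq {Γ : SimpleGraph V} {r : V} {f g : V → V}
    (hf : Γ.IsParentFun r f) (hg : Γ.IsParentFun r g)
    (h : parentGraph r f = parentGraph r g) : f = g := by
  funext v
  refine hf.induction (p := fun v => f v = g v) (hf.root.trans hg.root.symm) (fun v hv ih => ?_) v
  have h1 := hf.parentGraph_adj hv
  rw [h] at h1
  obtain ⟨_, ⟨_, h2⟩ | ⟨h3, h2⟩⟩ := h1
  · exact h2.symm
  -- Here the edge is `g`'s parent edge at `f v`. With the induction hypothesis, `f` swaps `v` and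
  -- `f v`, so its orbit from `v` never meets the root.
  · exfalso
    have h4 : f (f v) = v := ih.trans h2
    obtain ⟨k, hk⟩ := hf.reach v
    have : ∀ k, f^[k] v = v ∨ f^[k] v = f v := by
      intro k
      induction k with
      | zero => exact Or.inl rfl
      | succ k ih =>
        rw [Function.iterate_succ_apply']
        rcases ih with ih | ih <;> rw [ih]
        · exact Or.inr rfl
        · exact Or.inl h4
    rcases this k with h5 | h5
    · exact hv (h5.symm.trans hk)
    · exact h3 (h5.symm.trans hk)

/-- Take as parent a neighbour strictly closer to the root. The parent graph is then a connected
spanning subgraph of `T`, hence all of `T`, since trees are minimal connected graphs. -/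
lemma IsTree.exists_isParentFun {T : SimpleGraph V} (hT : T.IsTree) (r : V) :
    ∃ f, T.IsParentFun r f ∧ parentGraph r f = T := by
  classical
  have h : ∀ v, ∃ w, (v = r → w = r) ∧ (v ≠ r → T.Adj v w ∧ T.dist w r < T.dist v r) := by
    intro v
    by_cases hv : v = r
    · exact ⟨r, by simp [hv]⟩
    · obtain ⟨p, hp⟩ := hT.connected.exists_walk_length_eq_dist v r
      cases p with
      | nil => exact absurd rfl hv
      | cons hadj q =>
        refine ⟨_, fun h => absurd h hv, fun _ => ⟨hadj, ?_⟩⟩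
        rw [← hp, Walk.length_cons]
        exact Nat.lt_succ_of_le (dist_le q)
  choose f hf0 hf1 using h
  have hp : T.IsParentFun r f := by
    refine ⟨hf0 r rfl, fun v hv => (hf1 v hv).1, fun v => ?_⟩
    induction hd : T.dist v r using Nat.strong_induction_on generalizing v with
    | _ d ih =>
      by_cases hv : v = r
      · exact ⟨0, hv⟩
      · obtain ⟨k, hk⟩ := ih _ (hd ▸ (hf1 v hv).2) (f v) rfl
        exact ⟨k + 1, hk⟩
  exact ⟨f, hp, le_antisymm hp.parentGraph_le
    ((isTree_iff_minimal_connected.1 hT).2 hp.connected hp.parentGraph_le)⟩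

lemma numSpanningTrees_eq_ncard_isParentFun [Finite V] (Γ : SimpleGraph V) (r : V) :
    numSpanningTrees Γ = {f | Γ.IsParentFun r f}.ncard := by
  refine (Set.ncard_congr (fun f _ => parentGraph r f) (fun f hf => ?_) (fun f g hf hg h => ?_)
    (fun T hT => ?_)).symm
  · exact ⟨hf.parentGraph_le, hf.isTree⟩
  · exact IsParentFun.eq_of_parentGraph_eq hf hg h
  · obtain ⟨f, hf, rfl⟩ := hT.2.exists_isParentFun r
    exact ⟨f, ⟨hf.root, fun v hv => hT.1 (hf.adj v hv), hf.reach⟩, rfl⟩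

/-! ### The matrix-tree theorem -/

section MatrixTree

variable [Fintype V] [DecidableEq V]

/-- The Laplacian matrix of `Γ` with the rows indexed by `S` replaced by unit vectors. -/
def rootedLapMatrix (Γ : SimpleGraph V) [DecidableRel Γ.Adj] (S : Finset V) : Matrix V V ℚ :=
  Matrix.of fun v w => if v ∈ S then if v = w then 1 else 0
    else if v = w then (Γ.degree v : ℚ) else if Γ.Adj v w then -1 else 0

/-- The contribution of a choice of parents to the expansion of the rooted Laplacian. -/
def parentMatrix (r : V) (f : V → V) : Matrix V V ℚ :=
  1 - Matrix.of fun v w => if v ≠ r ∧ f v = w then 1 else 0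

lemma parentMatrix_mulVec (r : V) (f : V → V) (x : V → ℚ) (v : V) :
    (parentMatrix r f *ᵥ x) v = x v - if v ≠ r then x (f v) else 0 := by
  rw [parentMatrix, sub_mulVec, one_mulVec, Pi.sub_apply]
  by_cases hv : v = r <;> simp [mulVec, dotProduct, hv]

lemma rootedLapMatrix_singleton_row (Γ : SimpleGraph V) [DecidableRel Γ.Adj] (r v : V) :
    Γ.rootedLapMatrix {r} v = ∑ w ∈ (if v = r then {r} else Γ.neighborFinset v),
      fun u => ((if v = u then 1 else 0) - if v ≠ r ∧ w = u then 1 else 0 : ℚ) := by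
  ext u
  rw [Finset.sum_apply]
  by_cases hv : v = r
  · subst hv
    simp [rootedLapMatrix]
  · by_cases hu : v = u
    · subst hu
      simp [rootedLapMatrix, hv, Finset.sum_sub_distrib]
    · by_cases ha : Γ.Adj v u <;> simp [rootedLapMatrix, hv, hu, ha]

/-- Row `v ≠ r` of the Laplacian is the sum of `e_v - e_w` over neighbours `w`; multilinearity in
the rows turns the determinant into a sum over choices of one neighbour per vertex. -/
lemma det_rootedLapMatrix_singleton (Γ : SimpleGraph V) [DecidableRel Γ.Adj] (r : V) :
    (Γ.rootedLapMatrix {r}).det =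
      ∑ f ∈ Fintype.piFinset fun v => if v = r then {r} else Γ.neighborFinset v,
        (parentMatrix r f).det := by
  have h := (detRowAlternating (R := ℚ) (n := V)).toMultilinearMap.map_sum_finset
    (fun v w u => ((if v = u then 1 else 0) - if v ≠ r ∧ w = u then 1 else 0 : ℚ))
    (fun v => if v = r then {r} else Γ.neighborFinset v)
  rw [← funext (Γ.rootedLapMatrix_singleton_row r)] at h
  refine h.trans (Finset.sum_congr rfl fun f _ => congrArg Matrix.det ?_)
  ext v u
  simp [parentMatrix, one_apply]

/-- The parent step matrix `N` has zero row at the root, so it is nilpotent when every orbit reaches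
the root; its characteristic polynomial `X ^ |V|` is then evaluated at `1`. -/
lemma det_parentMatrix_of_reach {r : V} {f : V → V} (h : ∀ v, ∃ k, f^[k] v = r) :
    (parentMatrix r f).det = 1 := by
  set N : Matrix V V ℚ := Matrix.of fun v w => if v ≠ r ∧ f v = w then 1 else 0 with hN
  have h1 : parentMatrix r f = 1 - N := rfl
  have hpow : ∀ k v w, (∃ j ≤ k, f^[j] v = r) → (N ^ (k + 1)) v w = 0 := by
    intro k
    induction k with
    | zero =>
      rintro v w ⟨j, hj, hv⟩
      obtain rfl : j = 0 := by omega
      have : v = r := hv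
      simp [hN, this]
    | succ k ih =>
      rintro v w ⟨j, hj, hv⟩
      rw [pow_succ', mul_apply]
      refine Finset.sum_eq_zero fun u _ => ?_
      by_cases hu : v ≠ r ∧ f v = u
      · rw [ih, mul_zero]
        cases j with
        | zero => exact absurd hv hu.1
        | succ j => exact ⟨j, by omega, hu.2 ▸ hv⟩
      · simp [hN, hu]
  have hnil : IsNilpotent N := by
    choose k hk using h
    refine ⟨(∑ v, k v) + 1, ?_⟩
    ext v w
    exact hpow _ _ _ ⟨k v, Finset.single_le_sum (f := k) (fun _ _ => Nat.zero_le _) (mem_univ v),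
      hk v⟩
  have hc : N.charpoly = Polynomial.X ^ Fintype.card V :=
    sub_eq_zero.1 (isNilpotent_charpoly_sub_pow_of_isNilpotent hnil).eq_zero
  have := N.eval_charpoly 1
  rw [hc] at this
  simpa [h1] using this.symm

/-- The indicator of the vertices that never reach the root is a nonzero kernel vector. -/
lemma det_parentMatrix_of_not_reach {r : V} {f : V → V}
    (h : ¬ ∀ v, ∃ k, f^[k] v = r) : (parentMatrix r f).det = 0 := by
  classical
  push Not at h
  obtain ⟨v₀, hv₀⟩ := h
  refine exists_mulVec_eq_zero_iff.1
    ⟨fun v => if ∃ k, f^[k] v = r then 0 else 1, fun h0 => ?_, ?_⟩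
  · have := congrFun h0 v₀
    rw [if_neg (by push Not; exact hv₀)] at this
    exact one_ne_zero this
  · funext v
    rw [parentMatrix_mulVec]
    by_cases hv : v = r
    · rw [if_neg (not_not.2 hv), if_pos ⟨0, hv⟩, sub_zero, Pi.zero_apply]
    · have : (∃ k, f^[k] (f v) = r) ↔ ∃ k, f^[k] v = r := by
        constructor
        · rintro ⟨k, hk⟩
          exact ⟨k + 1, hk⟩
        · rintro ⟨_ | k, hk⟩
          · exact absurd hk hv
          · exact ⟨k, hk⟩
      simp only [if_pos hv, this, sub_self, Pi.zero_apply]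

/-- The **matrix-tree theorem**. -/
theorem numSpanningTrees_eq_det (Γ : SimpleGraph V) [DecidableRel Γ.Adj] (r : V) :
    (numSpanningTrees Γ : ℚ) = (Γ.rootedLapMatrix {r}).det := by
  classical
  rw [det_rootedLapMatrix_singleton, Γ.numSpanningTrees_eq_ncard_isParentFun r]
  have hmem : ∀ f : V → V,
      f ∈ Fintype.piFinset (fun v => if v = r then {r} else Γ.neighborFinset v) ↔
        f r = r ∧ ∀ v, v ≠ r → Γ.Adj v (f v) := by
    intro f
    rw [Fintype.mem_piFinset]
    constructor
    · intro h
      refine ⟨by simpa using h r, fun v hv => by simpa [hv] using h v⟩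
    · rintro ⟨h1, h2⟩ v
      by_cases hv : v = r
      · simp [hv, h1]
      · simpa [hv] using h2 v hv
  have hset : {f | Γ.IsParentFun r f} = ((Fintype.piFinset
      (fun v => if v = r then {r} else Γ.neighborFinset v)).filter
        (fun f => ∀ v, ∃ k, f^[k] v = r) : Finset (V → V)) := by
    ext f
    rw [Finset.mem_coe, Finset.mem_filter, hmem]
    exact ⟨fun h => ⟨⟨h.root, h.adj⟩, h.reach⟩, fun h => ⟨h.1.1, h.1.2, h.2⟩⟩
  rw [hset, Set.ncard_coe_finset, Finset.card_filter, Nat.cast_sum]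
  refine Finset.sum_congr rfl fun f _ => ?_
  split_ifs with h
  · rw [det_parentMatrix_of_reach h, Nat.cast_one]
  · rw [det_parentMatrix_of_not_reach h, Nat.cast_zero]

end MatrixTree

end SimpleGraph

/-! ### Graphs with two universal vertices -/

namespace SimpleGraph

lemma two_mul_det_rootedLapMatrix_of_universal {V : Type*} [Fintype V] [DecidableEq V]
    (Γ : SimpleGraph V) [DecidableRel Γ.Adj] {r c : V} (hrc : r ≠ c)
    (hr : ∀ v, v ≠ r → Γ.Adj r v) (hc : ∀ v, v ≠ c → Γ.Adj c v) :
    2 * (Γ.rootedLapMatrix {r}).det = Fintype.card V * (Γ.rootedLapMatrix {r, c}).det := by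
  set M := Γ.rootedLapMatrix {r} with hM
  set N : ℚ := (Fintype.card V : ℚ) with hN
  have hcard : 1 ≤ Fintype.card V := Fintype.card_pos_iff.2 ⟨r⟩
  have hdeg : ∀ u, (∀ v, v ≠ u → Γ.Adj u v) → (Γ.degree u : ℚ) = N - 1 := by
    intro u hu
    have : Γ.neighborFinset u = univ.erase u := by
      ext v
      simp only [mem_neighborFinset, mem_erase, mem_univ, and_true]
      exact ⟨fun h => h.ne', hu v⟩
    rw [← card_neighborFinset_eq_degree, this, card_erase_of_mem (mem_univ u), card_univ,
      Nat.cast_sub hcard, Nat.cast_one]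
  -- Weights: `N` at `r`, `2` at `c`, `1` elsewhere. Laplacian rows sum to zero, so the rows other
  -- than `r`, with `c` counted twice, give `L_c - L_r = N e_c - N e_r`; the unit row at `r` with
  -- weight `N` leaves `N e_c`.
  let k : V → ℚ := fun v => 1 + ((if v = r then N - 1 else 0) + if v = c then 1 else 0)
  have hrow : ∑ v, k v • M v = N • Pi.single c 1 := by
    ext w
    have hL : ∑ v, Γ.lapMatrix ℚ v w = 0 := by
      have := congrFun (Γ.lapMatrix_mulVec_const_eq_zero (R := ℚ)) w
      simp only [mulVec, dotProduct, mul_one, Pi.zero_apply] at this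
      simpa only [(Γ.isSymm_lapMatrix (R := ℚ)).apply w] using this
    have hMv : ∀ v, M v w = Γ.lapMatrix ℚ v w +
        if v = r then (if r = w then 1 else 0) - Γ.lapMatrix ℚ r w else 0 := by
      intro v
      by_cases hv : v = r
      · subst hv
        simp [hM, rootedLapMatrix]
      · by_cases hw : v = w
        · subst hw
          simp [hM, rootedLapMatrix, hv, lapMatrix, degMatrix]
        · by_cases ha : Γ.Adj v w <;>
            simp [hM, rootedLapMatrix, hv, hw, ha, lapMatrix, degMatrix]
    simp only [Finset.sum_apply, Pi.smul_apply, smul_eq_mul, k, add_mul, one_mul,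
      Finset.sum_add_distrib, ite_mul, zero_mul, Finset.sum_ite_eq', mem_univ, if_true]
    simp only [hMv, Finset.sum_add_distrib, hL, Finset.sum_ite_eq', mem_univ, if_true, hrc.symm,
      if_false]
    by_cases h1 : r = w
    · subst h1
      simp [lapMatrix, degMatrix, hdeg _ hr, hrc, hrc.symm, hc r hrc]
      ring
    · by_cases h2 : c = w
      · subst h2
        simp [lapMatrix, degMatrix, hdeg _ hc, hrc, hr c hrc.symm]
      · simp [lapMatrix, degMatrix, h1, h2, hr w (Ne.symm h1), hc w (Ne.symm h2),
          Ne.symm h2]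
  have h := det_updateRow_sum M c k
  rw [hrow, det_updateRow_smul] at h
  have hk : k c = 2 := by
    simp only [k, hrc.symm, if_false, if_true]
    norm_num
  rw [hk, smul_eq_mul] at h
  rw [← h]
  congr 2
  ext v w
  by_cases hv : v = c
  · subst hv
    simp [rootedLapMatrix, Pi.single_apply, eq_comm]
  · simp [hM, rootedLapMatrix, hv]

end SimpleGraph

/-! ### Determinants of the clique and pairing blocks -/

/-- The matrix is diagonal plus a rank-one term, so the matrix determinant lemma applies. The factor
`card ι` on the left avoids the exponent `#Sᶜ - 1`. -/
lemma card_mul_det_ite_sub_one {ι : Type*} [Fintype ι] [DecidableEq ι] [Nonempty ι]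
    (S : Finset ι) :
    (Fintype.card ι : ℚ) * (Matrix.of fun i j : ι => if i ∈ S then if i = j then (1 : ℚ) else 0
      else if i = j then (Fintype.card ι : ℚ) - 1 else -1).det =
    #S * (Fintype.card ι : ℚ) ^ #Sᶜ := by
  set N : ℚ := (Fintype.card ι : ℚ) with hN
  have hN0 : N ≠ 0 := by simp [hN]
  let d : ι → ℚ := fun i => if i ∈ S then 1 else N
  have hd : ∀ i, d i ≠ 0 := fun i => by
    by_cases h : i ∈ S <;> simp [d, h, hN0]
  have hdet : (diagonal d).det = N ^ #Sᶜ := by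
    rw [det_diagonal, Finset.prod_ite]
    simp [Finset.filter_not, Finset.compl_eq_univ_sdiff]
  have hM : (Matrix.of fun i j : ι => if i ∈ S then if i = j then (1 : ℚ) else 0
      else if i = j then N - 1 else -1) =
      diagonal d + replicateCol Unit (fun i => if i ∈ S then (0 : ℚ) else -1) *
        replicateRow Unit (fun _ => (1 : ℚ)) := by
    ext i j
    by_cases hij : i = j
    · subst hij
      by_cases hi : i ∈ S <;> simp [hi, d, mul_apply, sub_eq_add_neg]
    · by_cases hi : i ∈ S <;> simp [hi, hij, d, mul_apply]
  have hinv : (diagonal d)⁻¹ = diagonal fun i => (d i)⁻¹ :=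
    inv_eq_right_inv (by
      rw [diagonal_mul_diagonal, ← diagonal_one]
      exact congrArg diagonal (funext fun i => mul_inv_cancel₀ (hd i)))
  rw [hM, det_add_replicateCol_mul_replicateRow
    (by rw [hdet]; exact (pow_ne_zero _ hN0).isUnit), hdet, hinv, det_unique]
  have hs : ∑ i, (d i)⁻¹ * (if i ∈ S then 0 else -1 : ℚ) = - (#Sᶜ * N⁻¹) := by
    have : ∀ i, (d i)⁻¹ * (if i ∈ S then 0 else -1 : ℚ) = if i ∈ Sᶜ then -N⁻¹ else 0 := by
      intro i
      by_cases hi : i ∈ S <;> simp [d, hi]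
    rw [Finset.sum_congr rfl fun i _ => this i, Finset.sum_ite_mem, univ_inter, Finset.sum_const,
      nsmul_eq_mul, mul_neg]
  have hc : (#S : ℚ) + #Sᶜ = N := by
    rw [hN, ← Finset.card_add_card_compl S, Nat.cast_add]
  rw [Matrix.add_apply, one_apply_eq, mul_apply]
  simp only [mul_diagonal, replicateRow_apply, replicateCol_apply, one_mul, hs]
  field_simp
  linear_combination -hc

/-- The shift by `n` is a fixed-point-free involution, so splitting residues into `k` and `k + n`
with `k < n` yields `n` copies of the block with rows `(3, -1)`, `(-1, 3)`. -/
lemma det_three_sub_shift (n : ℕ) [NeZero n] :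
    (Matrix.of fun i j : ZMod (2 * n) =>
      if i = j then (3 : ℚ) else if j = i + n then -1 else 0).det = 8 ^ n := by
  have hn : 0 < n := NeZero.pos n
  let φ : Fin n ⊕ Fin n → ZMod (2 * n) := Sum.elim (fun k => (k : ℕ)) (fun k => ((k + n : ℕ)))
  have hφ : Function.Bijective φ := by
    rw [Fintype.bijective_iff_injective_and_card]
    refine ⟨?_, by simp [ZMod.card, two_mul]⟩
    rintro (i | i) (j | j) h <;>
      simp only [φ, Sum.elim_inl, Sum.elim_inr, ZMod.natCast_eq_natCast_iff'] at h <;>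
      rw [Nat.mod_eq_of_lt (by omega), Nat.mod_eq_of_lt (by omega)] at h
    · exact congrArg _ (Fin.ext h)
    · omega
    · omega
    · exact congrArg _ (Fin.ext (by omega))
  have h2 : (n : ZMod (2 * n)) + n = 0 := by
    have := ZMod.natCast_self (2 * n)
    rw [← two_mul]
    exact_mod_cast this
  have hs : ∀ i, φ i + n = φ i.swap := by
    rintro (i | i)
    · simp [φ]
    · simp [φ, add_assoc, h2]
  rw [← det_submatrix_equiv_self (Equiv.ofBijective φ hφ)]
  have : (Matrix.of fun i j : ZMod (2 * n) =>
      if i = j then (3 : ℚ) else if j = i + n then -1 else 0).submatrix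
        (Equiv.ofBijective φ hφ) (Equiv.ofBijective φ hφ) =
      fromBlocks (diagonal fun _ => 3) (-1) (-1) (diagonal fun _ => 3) := by
    ext i j
    simp only [submatrix_apply, of_apply, Equiv.ofBijective_apply, hs, hφ.1.eq_iff]
    rcases i with i | i <;> rcases j with j | j <;>
      simp [diagonal_apply, one_apply, eq_comm, apply_ite]
  rw [this]
  have : Invertible (diagonal fun _ : Fin n => (3 : ℚ)) :=
    ⟨diagonal fun _ => 3⁻¹, by simp, by simp⟩
  have hi : ⅟(diagonal fun _ : Fin n => (3 : ℚ)) = diagonal fun _ => 3⁻¹ :=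
    invOf_eq_right_inv (by simp)
  rw [det_fromBlocks₁₁, hi]
  have : diagonal (fun _ : Fin n => (3 : ℚ)) - -1 * diagonal (fun _ => 3⁻¹) * -1 =
      diagonal fun _ => 8 / 3 := by
    simp only [neg_mul, one_mul, mul_neg, mul_one, neg_neg, diagonal_sub]
    norm_num
  rw [this, det_diagonal, det_diagonal, ← Finset.prod_mul_distrib]
  norm_num

/-! ### The dihedral group -/

namespace DihedralGroup

variable {n : ℕ} [NeZero n]

lemma enhancedPowerGraph_adj_r_r {i j : ZMod n} :
    (enhancedPowerGraph (DihedralGroup n)).Adj (r i) (r j) ↔ i ≠ j := by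
  refine ⟨fun h => fun hij => h.1 (congrArg r hij), fun h => ⟨by simpa using h, r 1, ?_⟩⟩
  have : ∀ k : ZMod n, r k ∈ Subgroup.zpowers (r (1 : ZMod n)) := fun k =>
    ⟨k.val, by simp⟩
  exact ⟨this i, this j⟩

lemma mem_zpowers_sr {i : ZMod n} {x : DihedralGroup n} :
    x ∈ Subgroup.zpowers (sr i) ↔ x = r 0 ∨ x = sr i := by
  rw [mem_zpowers_iff_mem_range_orderOf, orderOf_sr]
  simp [Finset.range_add_one, or_comm]

lemma eq_sr_of_sr_mem_zpowers {i : ZMod n} {z : DihedralGroup n}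
    (h : sr i ∈ Subgroup.zpowers z) : z = sr i := by
  cases z with
  | r k =>
    obtain ⟨m, hm⟩ := h
    simp at hm
  | sr k => simpa [mem_zpowers_sr, -r_zero, eq_comm] using h

lemma enhancedPowerGraph_adj_sr {i : ZMod n} {x : DihedralGroup n} :
    (enhancedPowerGraph (DihedralGroup n)).Adj (sr i) x ↔ x = r 0 := by
  constructor
  · rintro ⟨hne, z, hi, hx⟩
    obtain rfl := eq_sr_of_sr_mem_zpowers hi
    exact (mem_zpowers_sr.1 hx).resolve_right hne.symm
  · rintro rfl
    exact ⟨by simp [-r_zero], sr i, by simp, by simp⟩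

theorem numSpanningTrees_enhancedPowerGraph :
    (numSpanningTrees (enhancedPowerGraph (DihedralGroup n)) : ℚ) = (n : ℚ) ^ ((n : ℤ) - 2) := by
  classical
  set Γ := enhancedPowerGraph (DihedralGroup n)
  have hn : (n : ℚ) ≠ 0 := by simp [NeZero.ne n]
  have hdr : ∀ i : ZMod n, i ≠ 0 → (Γ.degree (r i) : ℚ) = n - 1 := by
    intro i hi
    have : Γ.neighborFinset (r i) = (univ.erase i).image r := by
      ext x
      cases x with
      | r j => simp [Γ, enhancedPowerGraph_adj_r_r, eq_comm]
      | sr j => simp [Γ, SimpleGraph.adj_comm _ (r i), enhancedPowerGraph_adj_sr, hi, -r_zero]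
    rw [← SimpleGraph.card_neighborFinset_eq_degree, this,
      card_image_of_injective _ fun _ _ h => r.inj h, card_erase_of_mem (mem_univ _), card_univ,
      ZMod.card, Nat.cast_sub (NeZero.one_le), Nat.cast_one]
  have hdsr : ∀ i : ZMod n, Γ.degree (sr i) = 1 := by
    intro i
    have : Γ.neighborFinset (sr i) = {r 0} := by
      ext x
      simp [Γ, enhancedPowerGraph_adj_sr, -r_zero]
    rw [← SimpleGraph.card_neighborFinset_eq_degree, this, card_singleton]
  have hmat : (Γ.rootedLapMatrix {r 0}).submatrix equivSum.symm equivSum.symm =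
      fromBlocks (Matrix.of fun i j : ZMod n => if i ∈ ({0} : Finset (ZMod n)) then
        if i = j then (1 : ℚ) else 0 else if i = j then (Fintype.card (ZMod n) : ℚ) - 1 else -1) 0
        (Matrix.of fun _ j => if j = 0 then -1 else 0) 1 := by
    ext i j
    rcases i with i | i <;> rcases j with j | j
    · by_cases hi : i = 0
      · simp [SimpleGraph.rootedLapMatrix, hi, -r_zero]
      · by_cases hij : i = j
        · subst hij
          simp [SimpleGraph.rootedLapMatrix, hi, hdr i hi, -r_zero]
        · simp [SimpleGraph.rootedLapMatrix, hi, hij, Γ, enhancedPowerGraph_adj_r_r, -r_zero]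
    · by_cases hi : i = 0 <;>
        simp [SimpleGraph.rootedLapMatrix, hi, Γ, SimpleGraph.adj_comm _ (r i),
          enhancedPowerGraph_adj_sr, -r_zero]
    · simp [SimpleGraph.rootedLapMatrix, Γ, enhancedPowerGraph_adj_sr, -r_zero]
    · simp [SimpleGraph.rootedLapMatrix, hdsr, Γ, enhancedPowerGraph_adj_sr, one_apply, -r_zero]
  have hdet := card_mul_det_ite_sub_one ({0} : Finset (ZMod n))
  rw [SimpleGraph.numSpanningTrees_eq_det _ (r 0),
    ← det_submatrix_equiv_self equivSum.symm, hmat, det_fromBlocks_zero₁₂, det_one, mul_one]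
  rw [card_compl, card_singleton, ZMod.card, Nat.cast_one, one_mul] at hdet
  rw [ZMod.card]
  -- Multiplying by `n` turns the exponent `n - 2`, which is `-1` when `n = 1`, into the natural
  -- number `n - 1`.
  apply mul_left_cancel₀ hn
  rw [hdet, ← zpow_one_add₀ hn, ← zpow_natCast, Nat.cast_sub NeZero.one_le]
  congr 1
  push_cast
  ring

end DihedralGroup

/-! ### The generalized quaternion group -/

namespace QuaternionGroup

variable {n : ℕ}

lemma natCast_add_natCast_self : (n : ZMod (2 * n)) + n = 0 := by
  have := ZMod.natCast_self (2 * n)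
  rw [← two_mul]
  exact_mod_cast this

lemma natCast_self_ne_zero [NeZero n] : (n : ZMod (2 * n)) ≠ 0 := by
  rw [Ne, ZMod.natCast_eq_zero_iff]
  intro h
  have := Nat.le_of_dvd (NeZero.pos n) h
  have := NeZero.pos n
  omega

/-- The underlying type of the quaternion group is the disjoint union of two copies of
`ZMod (2 * n)`. -/
def sumEquiv : ZMod (2 * n) ⊕ ZMod (2 * n) ≃ QuaternionGroup n where
  toFun
    | .inl j => a j
    | .inr j => xa j
  invFun
    | a j => .inl j
    | xa j => .inr j
  left_inv := by rintro (x | x) <;> rfl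
  right_inv := by rintro (x | x) <;> rfl

variable [NeZero n]

lemma enhancedPowerGraph_adj_a_a {i j : ZMod (2 * n)} :
    (enhancedPowerGraph (QuaternionGroup n)).Adj (a i) (a j) ↔ i ≠ j := by
  refine ⟨fun h => fun hij => h.1 (congrArg a hij), fun h => ⟨by simpa using h, a 1, ?_⟩⟩
  have : ∀ k : ZMod (2 * n), a k ∈ Subgroup.zpowers (a (1 : ZMod (2 * n))) := fun k =>
    ⟨(k.val : ℕ), by
      simp only [zpow_natCast, a_one_pow, ZMod.natCast_zmod_val]⟩
  exact ⟨this i, this j⟩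

lemma mem_zpowers_xa {i : ZMod (2 * n)} {x : QuaternionGroup n} :
    x ∈ Subgroup.zpowers (xa i) ↔ x = a 0 ∨ x = a n ∨ x = xa i ∨ x = xa (i + (n : ZMod (2 * n))) := by
  have h3 : (xa i : QuaternionGroup n) ^ 3 = xa (i + (n : ZMod (2 * n))) := by
    rw [pow_succ', xa_sq, xa_mul_a]
  rw [mem_zpowers_iff_mem_range_orderOf, orderOf_xa]
  simp only [Finset.range_add_one, Finset.range_zero, mem_image, Finset.mem_insert,
    Finset.notMem_empty, or_false, exists_eq_or_imp, exists_eq_left, h3, xa_sq, pow_one, pow_zero,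
    a_zero]
  grind

/-- Powers of `a k` stay among the `a l`, and `xa k` generates a group of order four whose only
elements outside `⟨a⟩` are `xa k` and its inverse `xa (k + n)`. -/
lemma eq_xa_of_xa_mem_zpowers {i : ZMod (2 * n)} {z : QuaternionGroup n}
    (h : xa i ∈ Subgroup.zpowers z) : z = xa i ∨ z = xa (i + (n : ZMod (2 * n))) := by
  cases z with
  | a k =>
    exfalso
    rw [mem_zpowers_iff_mem_range_orderOf] at h
    simp only [mem_image] at h
    obtain ⟨m, -, hm⟩ := h
    have : ∀ m : ℕ, ∃ l, a k ^ m = a l := by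
      intro m
      induction m with
      | zero => exact ⟨0, by simp⟩
      | succ m ih =>
        obtain ⟨l, hl⟩ := ih
        exact ⟨l + k, by rw [pow_succ, hl, a_mul_a]⟩
    obtain ⟨l, hl⟩ := this m
    rw [hl] at hm
    cases hm
  | xa k =>
    have := natCast_add_natCast_self (n := n)
    rw [mem_zpowers_xa] at h
    simp only [reduceCtorEq, false_or, xa.injEq] at h ⊢
    grind

lemma enhancedPowerGraph_adj_xa {i : ZMod (2 * n)} {x : QuaternionGroup n} :
    (enhancedPowerGraph (QuaternionGroup n)).Adj (xa i) x ↔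
      x = a 0 ∨ x = a n ∨ x = xa (i + (n : ZMod (2 * n))) := by
  have h0 := natCast_add_natCast_self (n := n)
  constructor
  · rintro ⟨hne, z, hi, hx⟩
    rcases eq_xa_of_xa_mem_zpowers hi with rfl | rfl
    · rcases mem_zpowers_xa.1 hx with h | h | h | h
      exacts [Or.inl h, Or.inr (Or.inl h), absurd h.symm hne, Or.inr (Or.inr h)]
    · rcases mem_zpowers_xa.1 hx with h | h | h | h
      · exact Or.inl h
      · exact Or.inr (Or.inl h)
      · exact Or.inr (Or.inr h)
      · rw [add_assoc, h0, add_zero] at h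
        exact absurd h.symm hne
  · intro h
    refine ⟨?_, xa i, Subgroup.mem_zpowers _, mem_zpowers_xa.2 (by tauto)⟩
    rcases h with rfl | rfl | rfl
    · exact fun h => by cases h
    · exact fun h => by cases h
    · simpa using natCast_self_ne_zero

theorem numSpanningTrees_enhancedPowerGraph :
    numSpanningTrees (enhancedPowerGraph (QuaternionGroup n)) =
      2 ^ (5 * n - 1) * n ^ (2 * n - 2) := by
  classical
  set Γ := enhancedPowerGraph (QuaternionGroup n)
  have h0 : (0 : ZMod (2 * n)) ≠ n := natCast_self_ne_zero.symm
  have hn1 : 1 ≤ n := NeZero.one_le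
  have haxa : ∀ i j : ZMod (2 * n), Γ.Adj (a i) (xa j) ↔ i = 0 ∨ i = n := by
    intro i j
    simp [Γ, SimpleGraph.adj_comm _ (a i), enhancedPowerGraph_adj_xa, -a_zero]
  have hda : ∀ i : ZMod (2 * n), i ≠ 0 → i ≠ n →
      (Γ.degree (a i) : ℚ) = Fintype.card (ZMod (2 * n)) - 1 := by
    intro i hi hi'
    have : Γ.neighborFinset (a i) = (univ.erase i).image a := by
      ext x
      cases x with
      | a j => simp [Γ, enhancedPowerGraph_adj_a_a, eq_comm]
      | xa j => simp [haxa, hi, hi']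
    rw [← SimpleGraph.card_neighborFinset_eq_degree, this,
      card_image_of_injective _ fun _ _ h => a.inj h, card_erase_of_mem (mem_univ _), card_univ,
      Nat.cast_sub Fintype.card_pos, Nat.cast_one]
  have hdxa : ∀ i : ZMod (2 * n), Γ.degree (xa i) = 3 := by
    intro i
    have : Γ.neighborFinset (xa i) = {a 0, a n, xa (i + (n : ZMod (2 * n)))} := by
      ext x
      simp [Γ, enhancedPowerGraph_adj_xa, -a_zero]
    rw [← SimpleGraph.card_neighborFinset_eq_degree, this, card_eq_three]
    exact ⟨_, _, _, by simpa [-a_zero] using h0, by simp [-a_zero], by simp, rfl⟩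
  -- The upper right block vanishes because only `a 0` and `a n` are adjacent to any `xa j`, and
  -- both their rows are unit vectors.
  have hmat : (Γ.rootedLapMatrix {a 0, a n}).submatrix sumEquiv sumEquiv =
      fromBlocks (Matrix.of fun i j : ZMod (2 * n) => if i ∈ ({0, ↑n} : Finset (ZMod (2 * n))) then
        if i = j then (1 : ℚ) else 0 else
          if i = j then (Fintype.card (ZMod (2 * n)) : ℚ) - 1 else -1) 0
        (Matrix.of fun _ j : ZMod (2 * n) => if j = 0 ∨ j = n then -1 else 0)
        (Matrix.of fun i j : ZMod (2 * n) => if i = j then 3 else if j = i + n then -1 else 0) := by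
    ext i j
    rcases i with i | i <;> rcases j with j | j
    · by_cases hi : i = 0 ∨ i = n
      · simp [SimpleGraph.rootedLapMatrix, sumEquiv, hi, -a_zero]
      · by_cases hij : i = j
        · subst hij
          have hi' := not_or.1 hi
          simp [SimpleGraph.rootedLapMatrix, sumEquiv, hi, hda i hi'.1 hi'.2, -a_zero]
        · simp [SimpleGraph.rootedLapMatrix, sumEquiv, hi, hij, Γ, enhancedPowerGraph_adj_a_a,
            -a_zero]
    · by_cases hi : i = 0 ∨ i = n <;>
        simp [SimpleGraph.rootedLapMatrix, sumEquiv, hi, haxa, -a_zero]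
    · simp [SimpleGraph.rootedLapMatrix, sumEquiv, Γ, enhancedPowerGraph_adj_xa, -a_zero]
    · simp [SimpleGraph.rootedLapMatrix, sumEquiv, hdxa, Γ, enhancedPowerGraph_adj_xa, -a_zero]
  have huniv : ∀ c : ZMod (2 * n), c = 0 ∨ c = n → ∀ v, v ≠ a c → Γ.Adj (a c) v := by
    rintro c hc (j | j) hv
    · exact enhancedPowerGraph_adj_a_a.2 fun h => hv (congrArg a h.symm)
    · exact (haxa c j).2 hc
  have htwo := Γ.two_mul_det_rootedLapMatrix_of_universal (r := a 0) (c := a n)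
    (fun h => h0 (a.inj h)) (huniv 0 (Or.inl rfl)) (huniv n (Or.inr rfl))
  rw [← SimpleGraph.numSpanningTrees_eq_det, ← det_submatrix_equiv_self sumEquiv, hmat,
    det_fromBlocks_zero₁₂, det_three_sub_shift, QuaternionGroup.card] at htwo
  have hdet := card_mul_det_ite_sub_one ({0, ↑n} : Finset (ZMod (2 * n)))
  rw [card_compl, card_pair h0, ZMod.card] at hdet
  rw [ZMod.card] at htwo
  set D := det (Matrix.of fun i j : ZMod (2 * n) => if i ∈ ({0, ↑n} : Finset (ZMod (2 * n))) then
        if i = j then (1 : ℚ) else 0 else if i = j then ((2 * n : ℕ) : ℚ) - 1 else -1)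
  have hfin : (numSpanningTrees Γ : ℚ) = 2 * (2 * n) ^ (2 * n - 2) * 8 ^ n := by
    push_cast at htwo hdet
    linear_combination htwo / 2 + (8 : ℚ) ^ n * hdet
  have hpow : 2 * (2 * n) ^ (2 * n - 2) * 8 ^ n = 2 ^ (5 * n - 1) * n ^ (2 * n - 2) := by
    rw [show 5 * n - 1 = 1 + (2 * n - 2) + 3 * n by omega, pow_add, pow_add, pow_mul, mul_pow]
    ring
  rw [← hpow]
  exact_mod_cast hfin

end QuaternionGroup

theorem mainTheorem10 (n : ℕ) (hn : 1 ≤ n) :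
    numSpanningTrees (enhancedPowerGraph (QuaternionGroup n)) = 2 ^ (5 * n - 1) * n ^ (2 * n - 2) ∧
    (numSpanningTrees (enhancedPowerGraph (DihedralGroup n)) : ℚ) = (n : ℚ) ^ ((n : ℤ) - 2) := by
  have : NeZero n := ⟨by omega⟩
  exact ⟨QuaternionGroup.numSpanningTrees_enhancedPowerGraph,
    DihedralGroup.numSpanningTrees_enhancedPowerGraph⟩
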